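/- For $n \ge 1$ let $\varphi_n : \mathbb{C}^n \times \mathbb{C}^n \to \mathbb{C}$ be given by $\varphi_n((x_1,\dots,x_n),(y_1,\dots,y_n)) = \sum_{i=1}^n (x_i-y_i)^2$. A map $f : \mathbb{C}^n \to \mathbb{C}^n$ is said to preserve unit distance if for all $X, Y \in \mathbb{C}^n$, $\varphi_n(X,Y) = 1$ implies $\varphi_n(f(X),f(Y)) = 1$. Theorem. Let $n \ge 2$ and let $f : \mathbb{C}^n \to \mathbb{C}^n$ be a continuous map that preserves unit distance. Then there are a map $\rho : \mathbb{C} \to \mathbb{C}$, which is either the identity or the complex conjugation, and a complex affine map $I : \mathbb{C}^n \to \mathbb{C}^n$ whose linear part $L$ is orthogonal, i.e. $\sum_{i=1}^n (LX)_i (LY)_i = \sum_{i=1}^n x_i y_i$ for all $X, Y \in \mathbb{C}^n$, such that $f(x_1,\dots,x_n) = I(\rho(x_1),\dots,\rho(x_n))$ for all $(x_1,\dots,x_n) \in \mathbb{C}^n$. -/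

import Mathlib

/-- The complex bilinear "squared distance" `φ_n(X, Y) = ∑ (x_i - y_i)²` on `ℂⁿ`. -/
def phi {n : ℕ} (X Y : Fin n → ℂ) : ℂ := ∑ i, (X i - Y i) ^ 2

/-- `f : ℂⁿ → ℂⁿ` preserves the distance `d ∈ ℂ`. -/
def PreservesDistance {n : ℕ} (f : (Fin n → ℂ) → (Fin n → ℂ)) (d : ℂ) : Prop :=
  ∀ X Y : Fin n → ℂ, phi X Y = d ^ 2 → phi (f X) (f Y) = d ^ 2

/-- A complex linear map is orthogonal if it preserves the standard symmetric bilinear form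
`∑ x_i y_i` on `ℂⁿ` (no complex conjugation). -/
def IsOrthogonalLinear {n : ℕ} (L : (Fin n → ℂ) →ₗ[ℂ] (Fin n → ℂ)) : Prop :=
  ∀ X Y : Fin n → ℂ, ∑ i, L X i * L Y i = ∑ i, X i * Y i

/-! ### The bilinear form and its isometries -/

open scoped Matrix

/-! Preserving unit distance forces the preservation of all positive real squared distances. Any n
points at mutual distance 1 have exactly two common unit neighbours, at squared distance D =
2(n+1)/n from each other. So `f` preserves D unless it identifies such a pair, which a third point
rules out (`PreservesPhi.reflected_vertex`). The points at squared distance D from n - 1 of the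
vertices form a complex circle, which `f`, normalised to fix these vertices, maps to itself. A unit
chord of the circle subtends an angle incommensurable with π, by Niven's theorem, so continuity
forces all chords of the real circle to be preserved (`circle_chord`). This gives the squared
distances in (0, 2], and rescaling by √2 gives the rest.

Hence `f` agrees on ℝⁿ with an affine orthogonal map, which can be divided out. Distances from a +
ib to real points then force the value a ± ib, and the sign is constant because the pairs (a, b)
with b ≠ 0 form a connected set when n ≥ 2. -/

theorem phi_eq_dotProduct {n : ℕ} (X Y : Fin n → ℂ) : phi X Y = (X - Y) ⬝ᵥ (X - Y) := by
  simp [phi, dotProduct, sq]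

theorem phi_expand {n : ℕ} (X Y : Fin n → ℂ) : phi X Y = X ⬝ᵥ X - 2 * (X ⬝ᵥ Y) + Y ⬝ᵥ Y := by
  rw [phi_eq_dotProduct, sub_dotProduct, dotProduct_sub, dotProduct_sub, dotProduct_comm Y X]
  ring

theorem phi_comm {n : ℕ} (X Y : Fin n → ℂ) : phi X Y = phi Y X := by
  simp only [phi]
  exact Finset.sum_congr rfl fun i _ => by ring

theorem isOrthogonalLinear_iff {n : ℕ} (L : (Fin n → ℂ) →ₗ[ℂ] (Fin n → ℂ)) :
    IsOrthogonalLinear L ↔ ∀ X Y, L X ⬝ᵥ L Y = X ⬝ᵥ Y := Iff.rfl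

theorem phi_smul {n : ℕ} (c : ℂ) (X Y : Fin n → ℂ) : phi (c • X) (c • Y) = c ^ 2 * phi X Y := by
  simp only [phi, Finset.mul_sum, Pi.smul_apply, smul_eq_mul]
  exact Finset.sum_congr rfl fun i _ => by ring

/-- A homeomorphism of `ℂⁿ` preserving `phi`. -/
def IsPhiIsometry {n : ℕ} (e : (Fin n → ℂ) ≃ₜ (Fin n → ℂ)) : Prop :=
  ∀ X Y, phi (e X) (e Y) = phi X Y

theorem IsPhiIsometry.symm {n : ℕ} {e : (Fin n → ℂ) ≃ₜ (Fin n → ℂ)} (he : IsPhiIsometry e) :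
    IsPhiIsometry e.symm := fun X Y => by
  simpa using (he (e.symm X) (e.symm Y)).symm

theorem IsOrthogonalLinear.injective {n : ℕ} {L : (Fin n → ℂ) →ₗ[ℂ] (Fin n → ℂ)}
    (hL : IsOrthogonalLinear L) : Function.Injective L := by
  rw [isOrthogonalLinear_iff] at hL
  rw [injective_iff_map_eq_zero]
  intro X hX
  refine dotProduct_eq_zero X fun Y => ?_
  rw [← hL, hX, zero_dotProduct]

theorem IsOrthogonalLinear.exists_isometry {n : ℕ} {L : (Fin n → ℂ) →ₗ[ℂ] (Fin n → ℂ)}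
    (hL : IsOrthogonalLinear L) (c : Fin n → ℂ) :
    ∃ e : (Fin n → ℂ) ≃ₜ (Fin n → ℂ), IsPhiIsometry e ∧ ∀ X, e X = L X + c := by
  let E := (LinearEquiv.ofInjectiveEndo L hL.injective).toContinuousLinearEquiv
  refine ⟨E.toHomeomorph.trans (Homeomorph.addRight c), fun X Y => ?_, fun X => rfl⟩
  change phi (L X + c) (L Y + c) = _
  rw [phi_eq_dotProduct, phi_eq_dotProduct, add_sub_add_right_eq_sub, ← map_sub]
  exact hL _ _

/-- The linear map sending the standard basis to the family `u`. -/
def frameMap {n : ℕ} (u : Fin n → Fin n → ℂ) : (Fin n → ℂ) →ₗ[ℂ] (Fin n → ℂ) where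
  toFun X := ∑ i, X i • u i
  map_add' X Y := by simp [add_smul, Finset.sum_add_distrib]
  map_smul' c X := by simp [Finset.smul_sum, smul_smul]

theorem frameMap_isOrthogonal {n : ℕ} {u : Fin n → Fin n → ℂ}
    (hu : ∀ i j, u i ⬝ᵥ u j = if i = j then 1 else 0) : IsOrthogonalLinear (frameMap u) := by
  rw [isOrthogonalLinear_iff]
  intro X Y
  simp only [frameMap, LinearMap.coe_mk, AddHom.coe_mk, sum_dotProduct, dotProduct_sum,
    smul_dotProduct, dotProduct_smul, hu]
  simp [dotProduct, mul_comm]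

/-- Reflection in the hyperplane orthogonal to `w`. -/
noncomputable def reflectionMap {n : ℕ} (w : Fin n → ℂ) : (Fin n → ℂ) →ₗ[ℂ] (Fin n → ℂ) where
  toFun X := X - (2 * (X ⬝ᵥ w) / (w ⬝ᵥ w)) • w
  map_add' X Y := by
    ext i
    simp [add_dotProduct]
    ring
  map_smul' c X := by
    ext i
    simp
    ring

theorem reflectionMap_isOrthogonal {n : ℕ} {w : Fin n → ℂ} (hw : w ⬝ᵥ w ≠ 0) :
    IsOrthogonalLinear (reflectionMap w) := by
  rw [isOrthogonalLinear_iff]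
  intro X Y
  simp only [reflectionMap, LinearMap.coe_mk, AddHom.coe_mk, sub_dotProduct, dotProduct_sub,
    smul_dotProduct, dotProduct_smul, smul_eq_mul, dotProduct_comm w Y]
  field_simp
  ring

theorem reflectionMap_sub {n : ℕ} {u v : Fin n → ℂ} (h : u ⬝ᵥ u = v ⬝ᵥ v)
    (hw : (u - v) ⬝ᵥ (u - v) ≠ 0) : reflectionMap (u - v) u = v := by
  have h1 : (u - v) ⬝ᵥ (u - v) = 2 * (u ⬝ᵥ (u - v)) := by
    simp only [sub_dotProduct, dotProduct_sub, dotProduct_comm v u, ← h]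
    ring
  simp only [reflectionMap, LinearMap.coe_mk, AddHom.coe_mk]
  rw [← h1, div_self hw]
  simp

/-- Reflection along u - v works unless u - v is isotropic. In that case u + v is not, since the two
squares add up to 4 u·u, and minus the reflection along u + v works. -/
theorem exists_orthogonal_map_eq {n : ℕ} {u v : Fin n → ℂ} (h : u ⬝ᵥ u = v ⬝ᵥ v)
    (hu : u ⬝ᵥ u ≠ 0) :
    ∃ L : (Fin n → ℂ) →ₗ[ℂ] (Fin n → ℂ), IsOrthogonalLinear L ∧ L u = v := by
  by_cases hw : (u - v) ⬝ᵥ (u - v) = 0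
  · have hw' : (u - -v) ⬝ᵥ (u - -v) ≠ 0 := by
      intro h0
      apply hu
      have : (u - v) ⬝ᵥ (u - v) + (u - -v) ⬝ᵥ (u - -v) = 4 * (u ⬝ᵥ u) := by
        simp only [sub_dotProduct, dotProduct_sub, neg_dotProduct, dotProduct_neg, ← h]
        ring
      rw [hw, h0] at this
      simpa using this.symm
    refine ⟨-reflectionMap (u - -v), ?_, ?_⟩
    · have := (isOrthogonalLinear_iff _).1 (reflectionMap_isOrthogonal hw')
      rw [isOrthogonalLinear_iff]
      intro X Y
      simp only [LinearMap.neg_apply, neg_dotProduct_neg, this]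
    · rw [LinearMap.neg_apply, reflectionMap_sub (by simpa using h) hw', neg_neg]
  · exact ⟨_, reflectionMap_isOrthogonal hw, reflectionMap_sub h hw⟩

theorem exists_isometry_map_pair {n : ℕ} {x₀ y₀ x y : Fin n → ℂ} (h : phi x₀ y₀ = phi x y)
    (h0 : phi x y ≠ 0) :
    ∃ e : (Fin n → ℂ) ≃ₜ (Fin n → ℂ), IsPhiIsometry e ∧ e x₀ = x ∧ e y₀ = y := by
  obtain ⟨L, hL, hLu⟩ := exists_orthogonal_map_eq (u := x₀ - y₀) (v := x - y)
    (by rw [← phi_eq_dotProduct, ← phi_eq_dotProduct, h]) (by rwa [← phi_eq_dotProduct, h])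
  obtain ⟨e, he, hX⟩ := hL.exists_isometry (x - L x₀)
  refine ⟨e, he, by rw [hX]; abel, ?_⟩
  rw [map_sub] at hLu
  rw [hX, ← sub_eq_zero, ← sub_eq_zero.2 hLu.symm]
  abel

/-- `f` maps pairs at squared distance `r` to pairs at squared distance `r`. -/
def PreservesPhi {n : ℕ} (f : (Fin n → ℂ) → (Fin n → ℂ)) (r : ℂ) : Prop :=
  ∀ X Y, phi X Y = r → phi (f X) (f Y) = r

theorem preservesDistance_one_iff {n : ℕ} {f : (Fin n → ℂ) → (Fin n → ℂ)} :
    PreservesDistance f 1 ↔ PreservesPhi f 1 := by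
  simp [PreservesDistance, PreservesPhi]

theorem PreservesPhi.comp_isometry {n : ℕ} {f : (Fin n → ℂ) → (Fin n → ℂ)} {r : ℂ}
    (hf : PreservesPhi f r) {e e' : (Fin n → ℂ) ≃ₜ (Fin n → ℂ)} (he : IsPhiIsometry e)
    (he' : IsPhiIsometry e') : PreservesPhi (fun X => e' (f (e X))) r := fun X Y h => by
  rw [he']
  exact hf _ _ (by rwa [he])

/-! ### Regular unit simplices -/

theorem phi_single {n : ℕ} (X : Fin n → ℂ) (i : Fin n) (b : ℂ) :
    phi X (Pi.single i b) = X ⬝ᵥ X - 2 * b * X i + b ^ 2 := by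
  rw [phi_expand]
  simp
  ring

theorem phi_single_single {n : ℕ} {i j : Fin n} (hij : i ≠ j) (b : ℂ) :
    phi (Pi.single i b) (Pi.single j b) = 2 * b ^ 2 := by
  rw [phi_single]
  simp [hij.symm]
  ring

theorem phi_const_single {n : ℕ} (a b : ℂ) (i : Fin n) :
    phi (fun _ => a) (Pi.single i b) = n * a ^ 2 - 2 * a * b + b ^ 2 := by
  rw [phi_single]
  simp [dotProduct]
  ring

/-- Any regular unit simplex is the image under an isometry of the one whose vertices are the
multiples `b • eᵢ` of the standard basis and the point `(a, …, a)`. -/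
theorem exists_isometry_map_simplex {n : ℕ} {a b : ℂ} (hb : 2 * b ^ 2 = 1)
    (ha : n * a ^ 2 - 2 * a * b = 1 / 2) (P : Fin n → Fin n → ℂ) (Q : Fin n → ℂ)
    (hP : ∀ i j, i ≠ j → phi (P i) (P j) = 1) (hQ : ∀ i, phi Q (P i) = 1) :
    ∃ e : (Fin n → ℂ) ≃ₜ (Fin n → ℂ), IsPhiIsometry e ∧
      (∀ i, e (Pi.single i b) = P i) ∧ e (fun _ => a) = Q := by
  have hb0 : b ≠ 0 := by rintro rfl; simp at hb
  have hd : b - n * a ≠ 0 := by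
    intro h
    have h1 : (b - n * a) ^ 2 = ((n + 1 : ℕ) : ℂ) / 2 := by
      push_cast
      linear_combination (1 / 2) * hb + n * ha
    rw [h] at h1
    have h2 : ((n + 1 : ℕ) : ℂ) ≠ 0 := Nat.cast_ne_zero.2 (Nat.succ_ne_zero n)
    apply h2
    linear_combination -2 * h1
  set w : Fin n → Fin n → ℂ := fun i => P i - Q with hw
  have hww : ∀ i j, w i ⬝ᵥ w j = 1 / 2 + if i = j then 1 / 2 else 0 := by
    intro i j
    have hself : ∀ i, w i ⬝ᵥ w i = 1 := fun i => by
      rw [hw, ← phi_eq_dotProduct, phi_comm, hQ]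
    split_ifs with h
    · subst h
      rw [hself]
      norm_num
    · have h1 := hP i j h
      have h2 : P i - P j = w i - w j := by simp [hw]
      rw [phi_eq_dotProduct, h2, ← phi_eq_dotProduct, phi_expand, hself, hself] at h1
      linear_combination -(1 / 2) * h1
  set S := ∑ i, w i with hS
  have hwS : ∀ i, w i ⬝ᵥ S = (n + 1) / 2 := by
    intro i
    rw [hS, dotProduct_sum]
    simp only [hww, Finset.sum_add_distrib]
    simp
    ring
  have hSS : S ⬝ᵥ S = n * (n + 1) / 2 := by
    conv_lhs => rw [hS, sum_dotProduct]
    simp only [← hS, hwS]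
    simp
    ring
  -- The conditions b uᵢ + c = Pᵢ and a ∑ uⱼ + c = Q give b uᵢ - a ∑ uⱼ = wᵢ. Summing over i yields
  -- ∑ uⱼ = S / (b - n a), hence b uᵢ = wᵢ + κ S and c = Q - κ S.
  set κ := a / (b - n * a) with hκ
  have hκ1 : κ * (b - n * a) = a := div_mul_cancel₀ _ hd
  have hκ2 : 1 + 2 * κ * (n + 1) + κ ^ 2 * (n * (n + 1)) = 0 := by
    have h1 : (1 + 2 * κ * (n + 1) + κ ^ 2 * (n * (n + 1))) * (b - n * a) ^ 2 = 0 := by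
      have : (1 + 2 * κ * (n + 1) + κ ^ 2 * (n * (n + 1))) * (b - n * a) ^ 2
          = (b - n * a) ^ 2 + 2 * (κ * (b - n * a)) * (n + 1) * (b - n * a)
            + (κ * (b - n * a)) ^ 2 * (n * (n + 1)) := by ring
      rw [this, hκ1]
      linear_combination (1 / 2) * hb - ha
    exact (mul_eq_zero.1 h1).resolve_right (pow_ne_zero 2 hd)
  set u : Fin n → Fin n → ℂ := fun i => b⁻¹ • (w i + κ • S) with hu
  have hbinv : b⁻¹ * b⁻¹ = 2 := by
    field_simp
    linear_combination -hb
  have huu : ∀ i j, u i ⬝ᵥ u j = if i = j then 1 else 0 := by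
    intro i j
    simp only [hu, smul_dotProduct, dotProduct_smul, add_dotProduct, dotProduct_add, smul_eq_mul,
      hwS, hSS, hww, dotProduct_comm S (w j)]
    split_ifs
    · linear_combination
        (1 / 2 + 1 / 2 + κ * ((n + 1) / 2) + κ * ((n + 1) / 2 + κ * (n * (n + 1) / 2))) * hbinv
          + hκ2
    · linear_combination
        (1 / 2 + κ * ((n + 1) / 2) + κ * ((n + 1) / 2 + κ * (n * (n + 1) / 2))) * hbinv + hκ2
  obtain ⟨e, he, hX⟩ := (frameMap_isOrthogonal huu).exists_isometry (Q - κ • S)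
  refine ⟨e, he, fun i => ?_, ?_⟩
  · rw [hX]
    have : frameMap u (Pi.single i b) = w i + κ • S := by
      simp [frameMap, Pi.single_apply, hu, smul_smul, hb0, Finset.sum_add_distrib]
    rw [this]
    change P i - Q + _ + _ = _
    abel
  · rw [hX]
    have : frameMap u (fun _ => a) = κ • S := by
      simp only [frameMap, LinearMap.coe_mk, AddHom.coe_mk, hu, ← Finset.smul_sum,
        Finset.sum_add_distrib, ← hS]
      rw [Finset.sum_const, Finset.card_univ, Fintype.card_fin, ← Nat.cast_smul_eq_nsmul ℂ]
      have h1 : a * b⁻¹ * (1 + n * κ) = κ := by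
        field_simp
        linear_combination -hκ1
      conv_rhs => rw [← h1]
      module
    rw [this]
    abel

/-- Normalisation: up to an isometry of the target, the map fixes the standard simplex. -/
theorem PreservesPhi.exists_isometry_fix_simplex {n : ℕ} {a b : ℂ} (hb : 2 * b ^ 2 = 1)
    (ha : n * a ^ 2 - 2 * a * b = 1 / 2) {f : (Fin n → ℂ) → (Fin n → ℂ)}
    (hf : PreservesPhi f 1) :
    ∃ e : (Fin n → ℂ) ≃ₜ (Fin n → ℂ), IsPhiIsometry e ∧
      (∀ i, e (f (Pi.single i b)) = Pi.single i b) ∧ e (f fun _ => a) = fun _ => a := by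
  obtain ⟨e, he, h1, h2⟩ := exists_isometry_map_simplex hb ha (fun i => f (Pi.single i b))
    (f fun _ => a) (fun i j hij => hf _ _ (by rw [phi_single_single hij, hb]))
    (fun i => hf _ _ (by rw [phi_const_single]; linear_combination ha + (1 / 2) * hb))
  exact ⟨e.symm, he.symm, fun i => by rw [← h1, e.symm_apply_apply],
    by rw [← h2, e.symm_apply_apply]⟩

/-! ### The two apexes over a facet -/

theorem exists_sq_eq (z : ℂ) : ∃ w : ℂ, w ^ 2 = z := IsAlgClosed.exists_pow_nat_eq z two_pos

/-- The unit neighbours of all the b eᵢ are the points (t, …, t) with n t² - 2bt = 1/2, that is t =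
(b ± δ)/n. Once x, y are moved to these two points and the image simplex is normalised, the image of
y must be one of them. -/
theorem PreservesPhi.eq_or_phi_eq {n : ℕ} (hn : 1 ≤ n) {f : (Fin n → ℂ) → (Fin n → ℂ)}
    (hf : PreservesPhi f 1) {x y : Fin n → ℂ} (hxy : phi x y = 2 * (n + 1) / n) :
    f x = f y ∨ phi (f x) (f y) = 2 * (n + 1) / n := by
  have hn0 : (n : ℂ) ≠ 0 := Nat.cast_ne_zero.2 (by omega)
  have hn1 : (n : ℂ) + 1 ≠ 0 := by exact_mod_cast Nat.succ_ne_zero n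
  obtain ⟨b, hb⟩ := exists_sq_eq (1 / 2)
  obtain ⟨δ, hδ⟩ := exists_sq_eq ((n + 1) / 2)
  have hb' : 2 * b ^ 2 = 1 := by rw [hb]; norm_num
  set a := (b + δ) / n with ha
  set a' := (b - δ) / n with ha'
  have haa : n * a ^ 2 - 2 * a * b = 1 / 2 := by
    rw [ha]; field_simp; linear_combination 2 * hδ - 2 * hb
  have haa' : n * a' ^ 2 - 2 * a' * b = 1 / 2 := by
    rw [ha']; field_simp; linear_combination 2 * hδ - 2 * hb
  have hdist : phi (fun _ : Fin n => a) (fun _ => a') = 2 * (n + 1) / n := by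
    simp only [phi, Finset.sum_const, Finset.card_univ, Fintype.card_fin, nsmul_eq_mul]
    rw [ha, ha']; field_simp; linear_combination 4 * hδ
  obtain ⟨s, hs, hsx, hsy⟩ := exists_isometry_map_pair (hdist.trans hxy.symm) (by
    rw [hxy]
    exact div_ne_zero (mul_ne_zero two_ne_zero hn1) hn0)
  have hg : PreservesPhi (fun X => f (s X)) 1 := fun X Y h => hf _ _ (by rwa [hs])
  obtain ⟨e, he, hei, hea⟩ := hg.exists_isometry_fix_simplex hb' haa
  rw [hsx] at hea
  have hz : ∀ i, phi (e (f y)) (Pi.single i b) = 1 := fun i => by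
    rw [← hei, he]
    have h : phi (f (s fun _ => a')) (f (s (Pi.single i b))) = 1 := hg _ _ ?_
    · rwa [hsy] at h
    rw [phi_const_single]; linear_combination haa' + (1 / 2) * hb'
  set z := e (f y) with hzdef
  have hb0 : b ≠ 0 := by rintro h; simp [h] at hb
  have hzc : z = fun _ => z ⟨0, hn⟩ := by
    ext i
    have h1 := (hz i).trans (hz ⟨0, hn⟩).symm
    rw [phi_single, phi_single] at h1
    have h2 : 2 * b * (z i - z ⟨0, hn⟩) = 0 := by linear_combination -h1
    exact sub_eq_zero.1 ((mul_eq_zero.1 h2).resolve_left (by simpa using hb0))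
  set t := z ⟨0, hn⟩
  have ht := hz ⟨0, hn⟩
  rw [hzc, phi_const_single] at ht
  have htt : n * ((t - a) * (t - a')) = 0 := by
    have h1 : (n : ℂ) * ((t - a) * (t - a')) = n * t ^ 2 - 2 * t * b - 1 / 2 := by
      rw [ha, ha']; field_simp; linear_combination 2 * hb - 2 * hδ
    rw [h1]; linear_combination ht - hb
  rcases mul_eq_zero.1 ((mul_eq_zero.1 htt).resolve_left hn0) with h | h
  · left
    apply e.injective
    rw [hea, ← hzdef, hzc, sub_eq_zero.1 h]
  · right
    rw [← he, hea, ← hzdef, hzc, sub_eq_zero.1 h, hdist]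

/-- There is no triangle inequality over ℂ: with x = 0 and y = s e₀, the point t e₀ + w e₁ solves
both equations, because t is given by a linear equation and w by a square root. -/
theorem exists_phi_eq_and_phi_eq {n : ℕ} (hn : 2 ≤ n) {x y : Fin n → ℂ} {r : ℂ} (hr : r ≠ 0)
    (hxy : phi x y = r) (p q : ℂ) : ∃ z, phi x z = p ∧ phi y z = q := by
  obtain ⟨s, hs⟩ := exists_sq_eq r
  have hs0 : s ≠ 0 := by rintro rfl; simp at hs; exact hr hs.symm
  set t := (r + p - q) / (2 * s) with ht
  obtain ⟨w, hw⟩ := exists_sq_eq (p - t ^ 2)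
  let i : Fin n := ⟨0, by omega⟩
  let j : Fin n := ⟨1, by omega⟩
  have hij : i ≠ j := by simp [i, j]
  obtain ⟨e, he, hex, hey⟩ := exists_isometry_map_pair (x₀ := 0) (y₀ := Pi.single i s)
    (x := x) (y := y) (by rw [hxy, phi_single]; simp [hs]) (by rwa [hxy])
  refine ⟨e (Pi.single i t + Pi.single j w), ?_, ?_⟩
  · rw [← hex, he, phi_expand]
    simp [hij, hij.symm]
    linear_combination hw
  · rw [← hey, he, phi_expand]
    simp [hij, hij.symm]
    have : 2 * s * t = r + p - q := by rw [ht]; field_simp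
    linear_combination hw + hs - this

/-- If f x = f y, take z at squared distance D = 2(n+1)/n from x and 1 from y. Then f z is at
squared distance 1 from f x, but also at 0 or D, which is absurd. -/
theorem PreservesPhi.reflected_vertex {n : ℕ} (hn : 2 ≤ n) {f : (Fin n → ℂ) → (Fin n → ℂ)}
    (hf : PreservesPhi f 1) : PreservesPhi f (2 * (n + 1) / n) := by
  intro x y hxy
  have hn0 : (n : ℂ) ≠ 0 := Nat.cast_ne_zero.2 (by omega)
  have hn1 : (n : ℂ) + 1 ≠ 0 := by exact_mod_cast Nat.succ_ne_zero n
  refine (hf.eq_or_phi_eq (by omega) hxy).resolve_left fun hfxy => ?_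
  obtain ⟨z, hxz, hyz⟩ := exists_phi_eq_and_phi_eq hn
    (div_ne_zero (mul_ne_zero two_ne_zero hn1) hn0) hxy (2 * (n + 1) / n) 1
  have h1 := hf _ _ hyz
  rw [← hfxy] at h1
  rcases hf.eq_or_phi_eq (by omega) hxz with h | h
  · rw [h] at h1
    simp [phi] at h1
  · rw [h1] at h
    field_simp at h
    have : n = 2 * (n + 1) := by exact_mod_cast h
    omega

/-! ### Circle maps preserving an irrational chord -/

/-- By Niven's theorem a rational cosine of a rational multiple of π is 0, ±1/2 or ±1. -/
theorem dense_closure_angle {c : ℚ} (h1 : 1 / 2 < c) (h2 : c < 1) {θ : ℝ} (hθ : Real.cos θ = c) :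
    Dense (AddSubgroup.closure {θ, 2 * Real.pi} : Set ℝ) := by
  rw [dense_addSubgroupClosure_pair_iff]
  rintro ⟨r, hr⟩
  have hr' : θ = ((2 * r : ℚ) : ℝ) * Real.pi := by
    rw [eq_div_iff Real.two_pi_pos.ne'] at hr
    push_cast
    linarith
  have h1' : (1 / 2 : ℝ) < c := by simpa using (Rat.cast_lt (K := ℝ)).2 h1
  have h2' : (c : ℝ) < 1 := by exact_mod_cast h2
  have := niven ⟨_, hr'⟩ ⟨c, hθ⟩
  simp only [hθ, Set.mem_insert_iff, Set.mem_singleton_iff] at this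
  rcases this with h | h | h | h | h <;> linarith

/-- A continuous self-map of the complex circle `C² + S² = 1`, parametrised along the real circle,
which preserves one chord of irrational angle preserves all chords. -/
theorem circle_chord {C S : ℝ → ℂ} (hC : Continuous C) (hS : Continuous S)
    (hCS : ∀ t, C t ^ 2 + S t ^ 2 = 1) (hCp : ∀ t, C (t + 2 * Real.pi) = C t)
    (hSp : ∀ t, S (t + 2 * Real.pi) = S t) {θ : ℝ} (hθ : Real.sin θ ≠ 0)
    (hd : Dense (AddSubgroup.closure {θ, 2 * Real.pi} : Set ℝ))
    (hchord : ∀ t, C (t + θ) * C t + S (t + θ) * S t = Real.cos θ) (s t : ℝ) :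
    C (t + s) * C t + S (t + s) * S t = Real.cos s := by
  set Z : ℝ → ℂ := fun t => C t + Complex.I * S t with hZ
  set W : ℝ → ℂ := fun t => C t - Complex.I * S t with hW
  have hI := Complex.I_sq
  have hZW : ∀ t, Z t * W t = 1 := fun t => by
    simp only [hZ, hW]
    linear_combination hCS t - S t ^ 2 * hI
  have hZc : Continuous Z := by fun_prop
  have hWc : Continuous W := by fun_prop
  have hsum : ∀ s t, Z (t + s) * W t + W (t + s) * Z t
      = 2 * (C (t + s) * C t + S (t + s) * S t) := fun s t => by
    simp only [hZ, hW]
    linear_combination -2 * S (t + s) * S t * hI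
  -- The factor Z (t + θ) W t and its inverse have sum 2 cos θ, so it is exp(±iθ). These values
  -- differ as sin θ ≠ 0, so by continuity the sign does not depend on t.
  have hrot : ∃ ε : ℂ, (ε = 1 ∨ ε = -1) ∧
      ∀ t, Z (t + θ) = Complex.exp (ε * θ * Complex.I) * Z t := by
    have key := isPreconnected_univ.eq_or_eq_neg_of_sq_eq
      (f := fun t => Z (t + θ) * W t - Real.cos θ) (g := fun _ => Complex.I * Real.sin θ)
      (by fun_prop) (by fun_prop) (fun t _ => by
        simp only [Pi.pow_apply]
        have h1 := hsum θ t
        rw [hchord] at h1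
        have h2 : (Real.cos θ : ℂ) ^ 2 + (Real.sin θ : ℂ) ^ 2 = 1 := by
          exact_mod_cast Real.cos_sq_add_sin_sq θ
        linear_combination Z (t + θ) * W t * h1 - (Z (t + θ) * W (t + θ)) * hZW t - hZW (t + θ)
          + h2 - (Real.sin θ : ℂ) ^ 2 * hI)
      (fun _ => mul_ne_zero Complex.I_ne_zero (Complex.ofReal_ne_zero.2 hθ))
    rcases key with h | h
    · refine ⟨1, Or.inl rfl, fun t => ?_⟩
      have := h (Set.mem_univ t)
      simp only at this
      rw [one_mul, Complex.exp_mul_I, ← Complex.ofReal_cos, ← Complex.ofReal_sin]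
      linear_combination Z t * this - Z (t + θ) * hZW t
    · refine ⟨-1, Or.inr rfl, fun t => ?_⟩
      have := h (Set.mem_univ t)
      simp only [Pi.neg_apply] at this
      rw [neg_one_mul, Complex.exp_mul_I, Complex.cos_neg, Complex.sin_neg, ← Complex.ofReal_cos,
        ← Complex.ofReal_sin]
      linear_combination Z t * this - Z (t + θ) * hZW t
  obtain ⟨ε, hε, hrot⟩ := hrot
  -- The shifts that multiply Z by exp(εis) form a closed subgroup containing θ and 2π, hence all of
  -- ℝ.
  let H : AddSubgroup ℝ :=
    { carrier := {s | ∀ t, Z (t + s) = Complex.exp (ε * s * Complex.I) * Z t}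
      zero_mem' := fun t => by simp
      add_mem' := fun {x y} hx hy t => by
        rw [← add_assoc, hy, hx, ← mul_assoc, ← Complex.exp_add]
        push_cast
        ring_nf
      neg_mem' := fun {x} hx t => by
        have := hx (t + -x)
        rw [neg_add_cancel_right] at this
        rw [this, ← mul_assoc, ← Complex.exp_add]
        push_cast
        ring_nf
        simp }
  have hclosed : IsClosed (H : Set ℝ) := by
    have : (H : Set ℝ) = ⋂ t, {s | Z (t + s) = Complex.exp (ε * s * Complex.I) * Z t} := by
      ext s
      simp [H]
    rw [this]
    exact isClosed_iInter fun t => isClosed_eq (by fun_prop) (by fun_prop)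
  have hle : AddSubgroup.closure {θ, 2 * Real.pi} ≤ H := by
    rw [AddSubgroup.closure_le]
    rintro x (rfl | rfl)
    · exact hrot
    · intro t
      have : Complex.exp (ε * (2 * Real.pi : ℝ) * Complex.I) = 1 := by
        rcases hε with rfl | rfl
        · simp
        · rw [neg_one_mul, neg_mul, Complex.exp_neg]
          simp [Complex.exp_two_pi_mul_I]
      rw [this, one_mul]
      simp only [hZ, hCp, hSp]
  have hs : s ∈ (H : Set ℝ) := by
    have : (H : Set ℝ) = Set.univ := by
      rw [← hclosed.closure_eq]
      exact (hd.mono hle).closure_eq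
    rw [this]
    exact Set.mem_univ s
  have hZs : Z (t + s) = Complex.exp (ε * s * Complex.I) * Z t := hs t
  have hexp : Complex.exp (ε * s * Complex.I) * Complex.exp (-(ε * s * Complex.I)) = 1 := by
    rw [← Complex.exp_add, add_neg_cancel, Complex.exp_zero]
  have hWs : W (t + s) * Z t = Complex.exp (-(ε * s * Complex.I)) := by
    have := hZW (t + s)
    rw [hZs] at this
    linear_combination Complex.exp (-(ε * s * Complex.I)) * this - W (t + s) * Z t * hexp
  have hcos : Complex.exp (ε * s * Complex.I) + Complex.exp (-(ε * s * Complex.I))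
      = 2 * Real.cos s := by
    rw [Complex.ofReal_cos, Complex.two_cos]
    rcases hε with rfl | rfl
    · simp
    · simp [add_comm]
  have h := hsum s t
  rw [hWs, hZs, mul_assoc, hZW, mul_one, hcos] at h
  linear_combination -(1 / 2) * h

/-! ### The circle around n - 1 vertices -/

/-- The point with coordinate `s` in position `i` and all others equal to `t`. -/
def axialPoint {n : ℕ} (i : Fin n) (s t : ℂ) : Fin n → ℂ := (fun _ => t) + Pi.single i (s - t)

theorem axialPoint_self {n : ℕ} (i : Fin n) (s t : ℂ) : axialPoint i s t i = s := by
  simp [axialPoint]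

theorem axialPoint_of_ne {n : ℕ} {i j : Fin n} (h : j ≠ i) (s t : ℂ) :
    axialPoint i s t j = t := by
  simp [axialPoint, h]

theorem continuous_axialPoint {n : ℕ} (i : Fin n) {s t : ℝ → ℂ} (hs : Continuous s)
    (ht : Continuous t) : Continuous fun τ => axialPoint i (s τ) (t τ) := by
  refine continuous_pi fun j => ?_
  by_cases h : j = i
  · subst h
    simpa only [axialPoint_self] using hs
  · simpa only [axialPoint_of_ne h] using ht

theorem axialPoint_dotProduct {n : ℕ} (i : Fin n) (s t s' t' : ℂ) :
    axialPoint i s t ⬝ᵥ axialPoint i s' t' = s * s' + (n - 1) * (t * t') := by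
  simp only [axialPoint, add_dotProduct, dotProduct_add, dotProduct_single, single_dotProduct]
  simp [dotProduct]
  ring

theorem phi_axialPoint {n : ℕ} (i : Fin n) (s t s' t' : ℂ) :
    phi (axialPoint i s t) (axialPoint i s' t') = (s - s') ^ 2 + (n - 1) * (t - t') ^ 2 := by
  rw [phi_expand, axialPoint_dotProduct, axialPoint_dotProduct, axialPoint_dotProduct]
  ring

theorem phi_axialPoint_single {n : ℕ} {i j : Fin n} (h : j ≠ i) (s t b : ℂ) :
    phi (axialPoint i s t) (Pi.single j b) = s ^ 2 + (n - 1) * t ^ 2 - 2 * b * t + b ^ 2 := by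
  rw [phi_single, axialPoint_dotProduct, axialPoint_of_ne h]
  ring

theorem eq_axialPoint {n : ℕ} {i k : Fin n} (hik : k ≠ i) {b d : ℂ} (hb : b ≠ 0)
    {X : Fin n → ℂ} (hX : ∀ j ≠ i, phi X (Pi.single j b) = d) : X = axialPoint i (X i) (X k) := by
  ext j
  by_cases h : j = i
  · subst h
    rw [axialPoint_self]
  · rw [axialPoint_of_ne h]
    have h1 := (hX j h).trans (hX k hik).symm
    rw [phi_single, phi_single] at h1
    have h2 : 2 * b * (X j - X k) = 0 := by linear_combination -h1
    exact sub_eq_zero.1 ((mul_eq_zero.1 h2).resolve_left (by simpa using hb))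

/-- The squared radius of the circle of points at squared distance `2(n+1)/n` from `n - 1` points
at mutual distance one. -/
def chordRadiusSq (n : ℕ) : ℚ := 2 * (n + 1) / n - 1 / 2 + 1 / (2 * (n - 1))

/-- In `chordRadiusSq`, the amount 1/2 - 1/(2(n-1)) taken from D is the squared circumradius of the
n - 1 centres. The bound Q > 1 puts the cosine 1 - 1/(2Q) of the unit chord in (1/2, 1), and makes
the chords reach squared length 2. -/
theorem one_lt_chordRadiusSq {n : ℕ} (hn : 2 ≤ n) : 1 < chordRadiusSq n := by
  have h : (2 : ℚ) ≤ n := by exact_mod_cast hn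
  have h1 : (2 : ℚ) ≤ 2 * (n + 1) / n := by
    rw [le_div_iff₀ (by linarith)]
    linarith
  have h2 : (0 : ℚ) < 1 / (2 * (n - 1)) := by
    apply div_pos one_pos
    linarith
  rw [chordRadiusSq]
  linarith

/-- A pair at squared distance r is moved to a chord of the real circle around n - 1 vertices. The
normalised map fixes the vertices and preserves D, so it maps the circle into its complexification,
where `circle_chord` applies. -/
theorem PreservesPhi.of_le_two {n : ℕ} (hn : 2 ≤ n) {f : (Fin n → ℂ) → (Fin n → ℂ)}
    (hfc : Continuous f) (hf : PreservesPhi f 1) {r : ℝ} (hr0 : 0 < r) (hr2 : r ≤ 2) :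
    PreservesPhi f r := by
  intro x y hxy
  have hn0 : (n : ℂ) ≠ 0 := Nat.cast_ne_zero.2 (by omega)
  have hn1 : (n : ℂ) - 1 ≠ 0 := by
    rw [sub_ne_zero]
    exact_mod_cast (by omega : n ≠ 1)
  set Q := chordRadiusSq n with hQ
  have hQ1 : 1 < Q := one_lt_chordRadiusSq hn
  have hQR : (1 : ℝ) < Q := by exact_mod_cast hQ1
  have hQC : (Q : ℂ) = 2 * (n + 1) / n - 1 / 2 + 1 / (2 * (n - 1)) := by
    rw [hQ, chordRadiusSq]
    push_cast
    ring
  have hQ0 : (Q : ℂ) ≠ 0 := by exact_mod_cast (by linarith : Q ≠ 0)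
  obtain ⟨R, hR⟩ := exists_sq_eq (Q : ℂ)
  have hR0 : R ≠ 0 := by rintro rfl; simp at hR; exact hQ0 (by simpa using hR.symm)
  obtain ⟨ρ, hρ⟩ := exists_sq_eq ((Q : ℂ) / (n - 1))
  have hρ' : (n - 1) * ρ ^ 2 = (Q : ℂ) := by rw [hρ]; field_simp
  have hρ0 : ρ ≠ 0 := by rintro rfl; simp at hρ'; exact hQ0 (by simpa using hρ'.symm)
  obtain ⟨b, hb⟩ := exists_sq_eq (1 / 2)
  have hb0 : b ≠ 0 := by rintro rfl; simp at hb
  have hb' : 2 * b ^ 2 = 1 := by rw [hb]; norm_num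
  obtain ⟨δ, hδ⟩ := exists_sq_eq (((n : ℂ) + 1) / 2)
  have ha : n * ((b + δ) / n) ^ 2 - 2 * ((b + δ) / n) * b = 1 / 2 := by
    field_simp
    linear_combination 2 * hδ - 2 * hb
  set m := b / (n - 1) with hm
  have hm' : (n - 1) * m = b := by rw [hm]; field_simp
  let i : Fin n := ⟨0, by omega⟩
  let k : Fin n := ⟨1, by omega⟩
  have hki : k ≠ i := by simp [i, k]
  -- The centre (0, m, …, m) is the centroid of the b eⱼ with j ≠ i. The choices R² = Q and (n -
  -- 1)ρ² = Q make `P` scale the form by Q.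
  set P : ℂ → ℂ → Fin n → ℂ := fun c σ => axialPoint i (R * c) (m + ρ * σ) with hP
  have hPP : ∀ c σ c' σ', phi (P c σ) (P c' σ') = Q * ((c - c') ^ 2 + (σ - σ') ^ 2) :=
    fun c σ c' σ' => by
      simp only [hP, phi_axialPoint]
      linear_combination (c - c') ^ 2 * hR + (σ - σ') ^ 2 * hρ'
  have hPs : ∀ c σ, ∀ j ≠ i, phi (P c σ) (Pi.single j b)
      = Q * (c ^ 2 + σ ^ 2 - 1) + 2 * (n + 1) / n := fun c σ j hj => by
    have h1 : 2 * (n - 1) * m ^ 2 = 1 / (n - 1) := by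
      rw [hm]
      field_simp
      linear_combination 2 * hb
    have h2 : (1 : ℂ) / (2 * (n - 1)) = 1 / 2 * (1 / (n - 1)) := by field_simp
    rw [h2] at hQC
    simp only [hP, phi_axialPoint_single hj]
    linear_combination c ^ 2 * hR + σ ^ 2 * hρ' + (2 * ρ * σ + 2 * m) * hm' + hb - (1 / 2) * h1
      + hQC
  have hcs : ∀ t : ℝ, (Real.cos t : ℂ) ^ 2 + (Real.sin t : ℂ) ^ 2 = 1 := fun t => by
    exact_mod_cast Real.cos_sq_add_sin_sq t
  set γ : ℝ → Fin n → ℂ := fun t => P (Real.cos t) (Real.sin t) with hγ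
  have hγc : Continuous γ := continuous_axialPoint i (by fun_prop) (by fun_prop)
  have hγγ : ∀ t s, phi (γ (t + s)) (γ t) = 2 * Q * (1 - Real.cos s) := fun t s => by
    simp only [hγ, hPP]
    have h1 : (Real.cos s : ℂ) = Real.cos (t + s) * Real.cos t + Real.sin (t + s) * Real.sin t := by
      have := Real.cos_sub (t + s) t
      rw [add_sub_cancel_left] at this
      exact_mod_cast this
    linear_combination Q * hcs (t + s) + Q * hcs t + 2 * Q * h1
  -- position the pair on the circle
  obtain ⟨s, hs⟩ : ∃ s : ℝ, Real.cos s = 1 - r / (2 * Q) := by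
    have h1 : 0 < r / (2 * Q) := by positivity
    have h2 : r / (2 * Q) ≤ 2 := by
      rw [div_le_iff₀ (by positivity)]
      linarith
    exact ⟨Real.arccos (1 - r / (2 * Q)), Real.cos_arccos (by linarith) (by linarith)⟩
  have hsr : phi (γ (0 + s)) (γ 0) = r := by
    rw [hγγ, hs]
    push_cast
    field_simp
    ring
  obtain ⟨e, he, hex, hey⟩ := exists_isometry_map_pair (hsr.trans hxy.symm)
    (by rw [hxy]; exact_mod_cast hr0.ne')
  have hg : ∀ {q}, PreservesPhi f q → PreservesPhi (fun X => f (e X)) q :=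
    fun h X Y hXY => h _ _ (by rwa [he])
  obtain ⟨e', he', hfix, -⟩ := (hg hf).exists_isometry_fix_simplex hb' ha
  set g : (Fin n → ℂ) → (Fin n → ℂ) := fun X => e' (f (e X)) with hgdef
  have hgc : Continuous g := e'.continuous.comp (hfc.comp e.continuous)
  have hg1 : PreservesPhi g 1 := hf.comp_isometry he he'
  have hgD : PreservesPhi g (2 * (n + 1) / n) := (hf.reflected_vertex hn).comp_isometry he he'
  have hγs : ∀ t, ∀ j ≠ i, phi (g (γ t)) (Pi.single j b) = 2 * (n + 1) / n := fun t j hj => by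
    have h1 : g (Pi.single j b) = Pi.single j b := hfix j
    rw [← h1]
    apply hgD
    simp only [hγ, hPs _ _ j hj, hcs]
    ring
  set C : ℝ → ℂ := fun t => g (γ t) i / R with hC
  set S : ℝ → ℂ := fun t => (g (γ t) k - m) / ρ with hS
  have hgP : ∀ t, g (γ t) = P (C t) (S t) := fun t => by
    rw [eq_axialPoint hki hb0 (hγs t)]
    simp only [hP, hC, hS]
    congr 1
    · field_simp
    · field_simp
      ring
  have hCS : ∀ t, C t ^ 2 + S t ^ 2 = 1 := fun t => by
    have h1 := hγs t k hki
    rw [hgP, hPs _ _ k hki] at h1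
    have h2 : (Q : ℂ) * (C t ^ 2 + S t ^ 2 - 1) = 0 := by linear_combination h1
    linear_combination (mul_eq_zero.1 h2).resolve_left hQ0
  have hgg : ∀ t s, phi (g (γ (t + s))) (g (γ t))
      = 2 * Q * (1 - (C (t + s) * C t + S (t + s) * S t)) := fun t s => by
    rw [hgP, hgP, hPP]
    linear_combination Q * hCS (t + s) + Q * hCS t
  have hgγc : Continuous fun t => g (γ t) := hgc.comp hγc
  have hCc : Continuous C := ((continuous_apply i).comp hgγc).div_const R
  have hSc : Continuous S := (((continuous_apply k).comp hgγc).sub continuous_const).div_const ρ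
  have hγp : ∀ t, γ (t + 2 * Real.pi) = γ t := fun t => by
    simp only [hγ, Real.cos_add_two_pi, Real.sin_add_two_pi]
  -- the angle of the unit chord
  have hc1 : (1 : ℚ) / 2 < 1 - 1 / (2 * Q) := by
    have : 1 / (2 * Q) < 1 / 2 := by
      rw [div_lt_div_iff₀ (by linarith) two_pos]
      linarith
    linarith
  have hc2 : 1 - 1 / (2 * Q) < 1 := by
    have : 0 < 1 / (2 * Q) := by positivity
    linarith
  set θ := Real.arccos ((1 - 1 / (2 * Q) : ℚ) : ℝ) with hθ
  have hc1' : (1 / 2 : ℝ) < ((1 - 1 / (2 * Q) : ℚ) : ℝ) := by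
    simpa only [Rat.cast_div, Rat.cast_one, Rat.cast_ofNat] using (Rat.cast_lt (K := ℝ)).2 hc1
  have hc2' : ((1 - 1 / (2 * Q) : ℚ) : ℝ) < 1 := by exact_mod_cast hc2
  have hcosθ : Real.cos θ = ((1 - 1 / (2 * Q) : ℚ) : ℝ) :=
    Real.cos_arccos (by linarith) (by linarith)
  have hsinθ : Real.sin θ ≠ 0 := by
    intro h
    have := Real.cos_sq_add_sin_sq θ
    rw [h, hcosθ] at this
    nlinarith
  have hcosC : (Real.cos θ : ℂ) = 1 - 1 / (2 * Q) := by
    rw [hcosθ]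
    push_cast
    rfl
  have hchord : ∀ t, C (t + θ) * C t + S (t + θ) * S t = Real.cos θ := fun t => by
    have h1 : phi (γ (t + θ)) (γ t) = 1 := by
      rw [hγγ, hcosC]
      field_simp
      ring
    have h2 := hg1 _ _ h1
    rw [hgg] at h2
    rw [hcosC]
    field_simp
    linear_combination -h2
  have hmain := circle_chord hCc hSc hCS (fun t => by simp only [hC, hγp])
    (fun t => by simp only [hS, hγp]) hsinθ (dense_closure_angle hc1 hc2 hcosθ) hchord s 0
  rw [← hex, ← hey, ← he', ← hsr, hγγ, ← hmain]
  exact hgg 0 s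

/-! ### All positive squared distances -/

/-- As 2 is preserved, X ↦ f(√2 X)/√2 again preserves 1. The induction hypothesis for this map
doubles the bound, so the induction runs over all `f`. -/
theorem PreservesPhi.of_le_two_pow {n : ℕ} (hn : 2 ≤ n) (k : ℕ) :
    ∀ {f : (Fin n → ℂ) → (Fin n → ℂ)}, Continuous f → PreservesPhi f 1 →
      ∀ {r : ℝ}, 0 < r → r ≤ 2 ^ (k + 1) → PreservesPhi f r := by
  induction k with
  | zero => intro f hfc hf r h0 h1; exact hf.of_le_two hn hfc h0 (by simpa using h1)
  | succ k ih =>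
    intro f hfc hf r h0 h1 x y hxy
    obtain ⟨c, hc⟩ := exists_sq_eq 2
    have hc0 : c ≠ 0 := by rintro rfl; simp at hc
    have hinv : c⁻¹ ^ 2 = 1 / 2 := by rw [inv_pow, hc]; norm_num
    have hf2 : PreservesPhi f 2 := by
      have := hf.of_le_two hn hfc two_pos le_rfl
      exact_mod_cast this
    have hg : PreservesPhi (fun X => c⁻¹ • f (c • X)) 1 := fun X Y hXY => by
      rw [phi_smul, hf2 _ _ (by rw [phi_smul, hc, hXY, mul_one]), hinv]
      norm_num
    have h2 := ih (f := fun X => c⁻¹ • f (c • X)) (by fun_prop) hg (r := r / 2) (by positivity)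
      (by rw [div_le_iff₀ two_pos, ← pow_succ]; exact h1) (c⁻¹ • x) (c⁻¹ • y)
      (by rw [phi_smul, hinv, hxy]; push_cast; ring)
    simp only [smul_smul, mul_inv_cancel₀ hc0, one_smul] at h2
    rw [phi_smul, hinv] at h2
    push_cast at h2
    linear_combination 2 * h2

theorem PreservesPhi.of_pos {n : ℕ} (hn : 2 ≤ n) {f : (Fin n → ℂ) → (Fin n → ℂ)}
    (hfc : Continuous f) (hf : PreservesPhi f 1) {r : ℝ} (hr0 : 0 < r) : PreservesPhi f r := by
  obtain ⟨k, hk⟩ := pow_unbounded_of_one_lt r (one_lt_two : (1 : ℝ) < 2)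
  exact of_le_two_pow hn k hfc hf hr0
    (hk.le.trans (pow_le_pow_right₀ one_le_two (Nat.le_succ k)))

/-! ### Rigidity on the real points -/

/-- The inclusion of `ℝⁿ` in `ℂⁿ`. -/
def ofRealVec {n : ℕ} (x : Fin n → ℝ) : Fin n → ℂ := fun i => (x i : ℂ)

theorem ofRealVec_add {n : ℕ} (x y : Fin n → ℝ) :
    ofRealVec (x + y) = ofRealVec x + ofRealVec y := by
  ext i
  simp [ofRealVec]

theorem ofRealVec_neg {n : ℕ} (x : Fin n → ℝ) : ofRealVec (-x) = -ofRealVec x := by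
  ext i
  simp [ofRealVec]

theorem ofRealVec_smul {n : ℕ} (t : ℝ) (x : Fin n → ℝ) :
    ofRealVec (t • x) = (t : ℂ) • ofRealVec x := by
  ext i
  simp [ofRealVec]

theorem ofRealVec_dotProduct {n : ℕ} (x y : Fin n → ℝ) :
    ofRealVec x ⬝ᵥ ofRealVec y = ((x ⬝ᵥ y : ℝ) : ℂ) := by
  simp [ofRealVec, dotProduct]

theorem phi_ofRealVec {n : ℕ} (x y : Fin n → ℝ) :
    phi (ofRealVec x) (ofRealVec y) = (((x - y) ⬝ᵥ (x - y) : ℝ) : ℂ) := by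
  rw [phi_eq_dotProduct, ← ofRealVec_dotProduct, sub_eq_add_neg x, ofRealVec_add, ofRealVec_neg,
    ← sub_eq_add_neg]

theorem dotProduct_self_pos {n : ℕ} {x : Fin n → ℝ} (hx : x ≠ 0) : 0 < x ⬝ᵥ x :=
  lt_of_le_of_ne (Finset.sum_nonneg fun i _ => mul_self_nonneg (x i))
    fun h => hx (dotProduct_self_eq_zero.1 h.symm)

theorem ofRealVec_zero {n : ℕ} : ofRealVec (0 : Fin n → ℝ) = 0 := by
  ext i
  simp [ofRealVec]

theorem ofRealVec_single {n : ℕ} (i : Fin n) :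
    ofRealVec (Pi.single i 1) = Pi.single i (1 : ℂ) := by
  ext j
  by_cases h : j = i
  · subst h
    simp [ofRealVec]
  · simp [ofRealVec, h]

section

variable {n : ℕ} {f : (Fin n → ℂ) → (Fin n → ℂ)}

theorem phi_map_ofRealVec (hf : ∀ r : ℝ, 0 < r → PreservesPhi f r) (x y : Fin n → ℝ) :
    phi (f (ofRealVec x)) (f (ofRealVec y)) = phi (ofRealVec x) (ofRealVec y) := by
  by_cases h : x = y
  · subst h
    simp [phi]
  · rw [hf _ (dotProduct_self_pos (sub_ne_zero.2 h)) _ _ (phi_ofRealVec x y), phi_ofRealVec]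

/-- On `ℝⁿ`, a map preserving all positive squared distances is affine orthogonal. -/
theorem exists_orthogonal_eq_on_real (hf : ∀ r : ℝ, 0 < r → PreservesPhi f r) :
    ∃ L : (Fin n → ℂ) →ₗ[ℂ] (Fin n → ℂ), IsOrthogonalLinear L ∧
      ∀ x, f (ofRealVec x) = L (ofRealVec x) + f 0 := by
  set h : (Fin n → ℝ) → Fin n → ℂ := fun x => f (ofRealVec x) - f 0 with hh
  have hself : ∀ x, h x ⬝ᵥ h x = ofRealVec x ⬝ᵥ ofRealVec x := fun x => by
    have := phi_map_ofRealVec hf x 0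
    rw [ofRealVec_zero, phi_eq_dotProduct, phi_eq_dotProduct, sub_zero] at this
    exact this
  have hdot : ∀ x y, h x ⬝ᵥ h y = ofRealVec x ⬝ᵥ ofRealVec y := fun x y => by
    have h1 := phi_map_ofRealVec hf x y
    have h2 : f (ofRealVec x) - f (ofRealVec y) = h x - h y := by simp [hh]
    rw [phi_eq_dotProduct, h2, ← phi_eq_dotProduct, phi_expand, phi_expand, hself, hself] at h1
    linear_combination -(1 / 2) * h1
  have hu : ∀ i j, h (Pi.single i 1) ⬝ᵥ h (Pi.single j 1) = if i = j then 1 else 0 := by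
    intro i j
    rw [hdot, ofRealVec_single, ofRealVec_single]
    simp [Pi.single_apply, eq_comm]
  have hL := frameMap_isOrthogonal hu
  obtain ⟨e, he, heX⟩ := hL.exists_isometry (f 0)
  refine ⟨_, hL, fun x => ?_⟩
  rw [← heX]
  have he0 : e.symm (f 0) = 0 := by
    rw [e.symm_apply_eq, heX, map_zero, zero_add]
  have hei : ∀ i, e.symm (f (Pi.single i 1)) = Pi.single i 1 := fun i => by
    rw [e.symm_apply_eq, heX]
    simp [frameMap, Pi.single_apply, hh, ofRealVec_single]
  set z := e.symm (f (ofRealVec x)) with hz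
  have hz0 : z ⬝ᵥ z = ofRealVec x ⬝ᵥ ofRealVec x := by
    have := phi_map_ofRealVec hf x 0
    rw [ofRealVec_zero, ← he.symm, he0, phi_eq_dotProduct, phi_eq_dotProduct, sub_zero,
      sub_zero] at this
    exact this
  -- Distances to 0 and to eᵢ determine the i-th coordinate.
  have hzx : z = ofRealVec x := by
    ext i
    have := phi_map_ofRealVec hf x (Pi.single i 1)
    rw [ofRealVec_single, ← he.symm, hei, phi_single, phi_single, hz0] at this
    linear_combination -(1 / 2) * this
  have hez := e.apply_symm_apply (f (ofRealVec x))
  rw [← hz, hzx] at hez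
  exact hez.symm

/-! ### Maps fixing the real points -/

/-- A vector of `ℂⁿ` from its real and imaginary parts. -/
noncomputable def complexVec (a b : Fin n → ℝ) : Fin n → ℂ :=
  ofRealVec a + Complex.I • ofRealVec b

theorem exists_lt_sq_mul {p q : ℝ} (hp : 0 < p) (hq : 0 ≤ q) : ∃ t : ℝ, t ≠ 0 ∧ q < t ^ 2 * p := by
  refine ⟨q / p + 1, by positivity, ?_⟩
  have h : q / p * p = q := div_mul_cancel₀ q hp.ne'
  have h0 : 0 ≤ q / p := by positivity
  nlinarith [mul_nonneg h0 hq]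

/-- For v ⊥ b the squared distance from a + ib to a ± v is v·v - b·b, which is positive and hence
preserved. Adding and subtracting the two resulting equations separates W·W from W·v. -/
theorem dotProduct_of_fix_real (hf : ∀ r : ℝ, 0 < r → PreservesPhi f r)
    (hfix : ∀ x, f (ofRealVec x) = ofRealVec x) {a b v : Fin n → ℝ} (hv : v ⬝ᵥ b = 0)
    (hlt : b ⬝ᵥ b < v ⬝ᵥ v) :
    (f (complexVec a b) - ofRealVec a) ⬝ᵥ ofRealVec v = 0 ∧
      (f (complexVec a b) - ofRealVec a) ⬝ᵥ (f (complexVec a b) - ofRealVec a)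
        = -((b ⬝ᵥ b : ℝ) : ℂ) := by
  set W := f (complexVec a b) - ofRealVec a with hW
  have key : ∀ v : Fin n → ℝ, v ⬝ᵥ b = 0 → b ⬝ᵥ b < v ⬝ᵥ v →
      W ⬝ᵥ W - 2 * (W ⬝ᵥ ofRealVec v) = -((b ⬝ᵥ b : ℝ) : ℂ) := by
    intro v hv hlt
    have h1 : phi (complexVec a b) (ofRealVec (a + v)) = ((v ⬝ᵥ v - b ⬝ᵥ b : ℝ) : ℂ) := by
      rw [phi_eq_dotProduct, ofRealVec_add, complexVec, add_sub_add_left_eq_sub,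
        ← phi_eq_dotProduct, phi_expand]
      simp only [smul_dotProduct, dotProduct_smul, ofRealVec_dotProduct, smul_eq_mul,
        dotProduct_comm b v, hv]
      push_cast
      linear_combination ((b ⬝ᵥ b : ℝ) : ℂ) * Complex.I_sq
    have h2 := hf _ (sub_pos.2 hlt) _ _ h1
    have h3 : f (complexVec a b) - ofRealVec (a + v) = W - ofRealVec v := by
      rw [hW, ofRealVec_add]
      abel
    rw [hfix, phi_eq_dotProduct, h3, ← phi_eq_dotProduct, phi_expand, ofRealVec_dotProduct] at h2
    push_cast at h2
    linear_combination h2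
  have h1 := key v hv hlt
  have h2 := key (-v) (by simp [hv]) (by simpa using hlt)
  rw [ofRealVec_neg, dotProduct_neg] at h2
  exact ⟨by linear_combination (1 / 4) * h2 - (1 / 4) * h1,
    by linear_combination (1 / 2) * h1 + (1 / 2) * h2⟩

/-- Vectors v ⊥ b can be scaled to be long, so W is orthogonal to all of them and is a multiple μb.
Then W·W = -b·b gives μ² = -1; n ≥ 2 supplies a nonzero v. -/
theorem exists_sq_eq_neg_one_of_fix_real (hn : 2 ≤ n) (hf : ∀ r : ℝ, 0 < r → PreservesPhi f r)
    (hfix : ∀ x, f (ofRealVec x) = ofRealVec x) (a : Fin n → ℝ) {b : Fin n → ℝ} (hb : b ≠ 0) :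
    ∃ μ : ℂ, μ ^ 2 = -1 ∧ f (complexVec a b) = ofRealVec a + μ • ofRealVec b := by
  set W := f (complexVec a b) - ofRealVec a with hW
  have hbb := dotProduct_self_pos hb
  have hbC : ((b ⬝ᵥ b : ℝ) : ℂ) ≠ 0 := by exact_mod_cast hbb.ne'
  have horth : ∀ v : Fin n → ℝ, v ⬝ᵥ b = 0 → v ≠ 0 →
      W ⬝ᵥ ofRealVec v = 0 ∧ W ⬝ᵥ W = -((b ⬝ᵥ b : ℝ) : ℂ) := by
    intro v hv hv0
    obtain ⟨t, ht0, ht⟩ := exists_lt_sq_mul (dotProduct_self_pos hv0) hbb.le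
    obtain ⟨h1, h2⟩ := dotProduct_of_fix_real hf hfix (a := a) (b := b) (v := t • v)
      (by simp [hv]) (by simpa [sq, mul_assoc] using ht)
    refine ⟨?_, h2⟩
    rw [ofRealVec_smul, dotProduct_smul, smul_eq_mul] at h1
    exact (mul_eq_zero.1 h1).resolve_left (by exact_mod_cast ht0)
  have : Nontrivial (Fin n) := Fin.nontrivial_iff_two_le.2 hn
  obtain ⟨v, hv0, hv⟩ := exists_ne_zero_dotProduct_eq_zero b
  have hWW := (horth v hv hv0).2
  set μ := (W ⬝ᵥ ofRealVec b) / ((b ⬝ᵥ b : ℝ) : ℂ) with hμ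
  have hWb : W = μ • ofRealVec b := by
    ext j
    -- A multiple of the component of eⱼ orthogonal to b; W·w = 0 gives the j-th coordinate of W.
    set w : Fin n → ℝ := (b ⬝ᵥ b) • Pi.single j 1 + (-b j) • b with hw
    have hw0 : W ⬝ᵥ ofRealVec w = 0 := by
      by_cases h0 : w = 0
      · rw [h0, ofRealVec_zero, dotProduct_zero]
      · refine (horth w ?_ h0).1
        simp [hw, add_dotProduct]
        ring
    rw [hw, ofRealVec_add, ofRealVec_smul, ofRealVec_smul, ofRealVec_single, dotProduct_add,
      dotProduct_smul, dotProduct_smul, dotProduct_single, smul_eq_mul, smul_eq_mul] at hw0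
    simp only [Pi.smul_apply, smul_eq_mul, hμ, ofRealVec]
    rw [div_mul_eq_mul_div, eq_div_iff hbC]
    push_cast at hw0
    change _ = (W ⬝ᵥ ofRealVec b) * _
    linear_combination hw0
  refine ⟨μ, ?_, ?_⟩
  · rw [hWb, smul_dotProduct, dotProduct_smul, ofRealVec_dotProduct] at hWW
    simp only [smul_eq_mul] at hWW
    have : ((b ⬝ᵥ b : ℝ) : ℂ) * (μ ^ 2 + 1) = 0 := by linear_combination hWW
    linear_combination (mul_eq_zero.1 this).resolve_left hbC
  · rw [← hWb, hW]
    abel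

/-- The multiplier μ = ±i depends continuously on (a, b) for b ≠ 0, and removing the origin leaves
ℝⁿ connected when n ≥ 2. -/
theorem eq_id_or_conj_of_fix_real (hn : 2 ≤ n) (hfc : Continuous f)
    (hf : ∀ r : ℝ, 0 < r → PreservesPhi f r) (hfix : ∀ x, f (ofRealVec x) = ofRealVec x) :
    (∀ a b, f (complexVec a b) = complexVec a b) ∨
      ∀ a b, f (complexVec a b) = complexVec a (-b) := by
  have hμ := exists_sq_eq_neg_one_of_fix_real hn hf hfix
  have h0 : ∀ a, f (complexVec a 0) = ofRealVec a := fun a => by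
    rw [complexVec, ofRealVec_zero, smul_zero, add_zero, hfix]
  set T : Set ((Fin n → ℝ) × (Fin n → ℝ)) := Set.univ ×ˢ {0}ᶜ with hT
  have hTc : IsPreconnected T := by
    refine isPreconnected_univ.prod (isConnected_compl_singleton_of_one_lt_rank ?_ 0).isPreconnected
    rw [rank_fin_fun]
    exact_mod_cast hn
  set m : (Fin n → ℝ) × (Fin n → ℝ) → ℂ := fun p =>
    ((f (complexVec p.1 p.2) - ofRealVec p.1) ⬝ᵥ ofRealVec p.2) / ((p.2 ⬝ᵥ p.2 : ℝ) : ℂ) with hm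
  have hmT : ∀ p ∈ T, m p ^ 2 = -1 ∧
      f (complexVec p.1 p.2) = ofRealVec p.1 + m p • ofRealVec p.2 := by
    rintro ⟨a, b⟩ ⟨-, hb⟩
    have hb : b ≠ 0 := hb
    obtain ⟨μ, h1, h2⟩ := hμ a hb
    have hbC : ((b ⬝ᵥ b : ℝ) : ℂ) ≠ 0 := by exact_mod_cast (dotProduct_self_pos hb).ne'
    have h3 : m (a, b) = μ := by
      simp only [hm, h2, add_sub_cancel_left, smul_dotProduct, ofRealVec_dotProduct, smul_eq_mul]
      exact mul_div_cancel_right₀ _ hbC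
    exact h3 ▸ ⟨h1, h2⟩
  have hvec : Continuous (ofRealVec : (Fin n → ℝ) → Fin n → ℂ) := by
    unfold ofRealVec
    fun_prop
  have hcv : Continuous fun p : (Fin n → ℝ) × (Fin n → ℝ) => complexVec p.1 p.2 := by
    unfold complexVec
    fun_prop
  have hmc : ContinuousOn m T := by
    refine ContinuousOn.div (Continuous.continuousOn ?_) (Continuous.continuousOn ?_) ?_
    · exact ((hfc.comp hcv).sub (hvec.comp continuous_fst)).dotProduct (hvec.comp continuous_snd)
    · exact Complex.continuous_ofReal.comp (continuous_snd.dotProduct continuous_snd)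
    · rintro ⟨a, b⟩ ⟨-, hb⟩
      exact_mod_cast (dotProduct_self_pos hb).ne'
  rcases hTc.eq_or_eq_neg_of_sq_eq hmc (g := fun _ => Complex.I) continuousOn_const
    (fun p hp => by simp [(hmT p hp).1]) (fun _ => Complex.I_ne_zero) with h | h
  · left
    intro a b
    by_cases hb : b = 0
    · rw [hb, h0, complexVec, ofRealVec_zero, smul_zero, add_zero]
    · have hp : (a, b) ∈ T := ⟨trivial, hb⟩
      exact (hmT _ hp).2.trans (by rw [h hp]; rfl)
  · right
    intro a b
    by_cases hb : b = 0
    · rw [hb, h0, complexVec, neg_zero, ofRealVec_zero, smul_zero, add_zero]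
    · have hp : (a, b) ∈ T := ⟨trivial, hb⟩
      refine (hmT _ hp).2.trans ?_
      rw [h hp, complexVec, ofRealVec_neg, smul_neg, Pi.neg_apply, neg_smul]

theorem complexVec_re_im (X : Fin n → ℂ) :
    complexVec (fun i => (X i).re) (fun i => (X i).im) = X := by
  ext i
  simp only [complexVec, ofRealVec, Pi.add_apply, Pi.smul_apply, smul_eq_mul]
  rw [mul_comm, Complex.re_add_im]

theorem complexVec_re_neg_im (X : Fin n → ℂ) :
    complexVec (fun i => (X i).re) (-fun i => (X i).im) = fun i => starRingEnd ℂ (X i) := by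
  ext i
  apply Complex.ext <;> simp [complexVec, ofRealVec]

end

theorem theorem4 (n : ℕ) (hn : 2 ≤ n) (f : (Fin n → ℂ) → (Fin n → ℂ))
    (hf : Continuous f) (hunit : PreservesDistance f 1) :
    ∃ (ρ : ℂ → ℂ) (I : (Fin n → ℂ) →ᵃ[ℂ] (Fin n → ℂ)),
      (ρ = id ∨ ρ = fun z : ℂ => starRingEnd ℂ z) ∧
      IsOrthogonalLinear I.linear ∧
      f = I ∘ fun (X : Fin n → ℂ) (i : Fin n) => ρ (X i) := by
  have hpos : ∀ r : ℝ, 0 < r → PreservesPhi f r := fun r hr =>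
    (preservesDistance_one_iff.1 hunit).of_pos hn hf hr
  obtain ⟨L, hL, hreal⟩ := exists_orthogonal_eq_on_real hpos
  obtain ⟨e, he, heX⟩ := hL.exists_isometry (f 0)
  let I : (Fin n → ℂ) →ᵃ[ℂ] (Fin n → ℂ) :=
    { toFun := fun X => L X + f 0
      linear := L
      map_vadd' := fun p v => by simp [add_assoc] }
  have hI : ∀ X, I X = e X := fun X => (heX X).symm
  -- Composing with the inverse of the affine map found on ℝⁿ yields a map fixing ℝⁿ.
  have hg := eq_id_or_conj_of_fix_real (f := fun X => e.symm (f X)) hn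
    (e.symm.continuous.comp hf)
    (fun r hr X Y h => by rw [he.symm]; exact hpos r hr X Y h)
    (fun x => by rw [e.symm_apply_eq, heX, hreal])
  rcases hg with hg | hg
  · refine ⟨id, I, Or.inl rfl, hL, funext fun X => ?_⟩
    have h := hg (fun i => (X i).re) (fun i => (X i).im)
    rw [complexVec_re_im, e.symm_apply_eq] at h
    exact h.trans (hI X).symm
  · refine ⟨fun z => starRingEnd ℂ z, I, Or.inr rfl, hL, funext fun X => ?_⟩
    have h := hg (fun i => (X i).re) (fun i => (X i).im)
    rw [complexVec_re_im, complexVec_re_neg_im, e.symm_apply_eq] at h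
    exact h.trans (hI _).symm
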